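/- Let $M$ be a smooth manifold of odd dimension $2m+1$ with a CR structure $(H,J)$: $H\subset TM$ is a contact distribution of codimension $1$ and $J$ is a smooth complex structure on $H$ ($J^2=-\mathrm{id}_H$) such that, for all $X,Y\in\Gamma(H)$, $[JX,Y]+[X,JY]\in\Gamma(H)$ and $J([JX,Y]+[X,JY])-[JX,JY]+[X,Y]=0$. Let $\theta$ be a pseudo-Hermitian structure, i.e. a nowhere vanishing real $1$-form with $\theta|_H=0$, and let $T$ be its Reeb vector field, determined by $\theta(T)=1$ and $d\theta(T,\cdot)=0$, where $d\theta(X,Y)=X(\theta(Y))-Y(\theta(X))-\theta([X,Y])$. Extend $J$ to $TM$ by $J(T)=0$, put $L_\theta=d\theta(\cdot,J\cdot)$ and $g_\theta=L_\theta+\theta\otimes\theta$ (of arbitrary signature), and let $\nabla^W$ be the Tanaka–Webster connection, i.e. the unique connection on $TM$ with $\nabla^W g_\theta=0$ whose torsion satisfies $\mathrm{Tor}^W(X,Y)=L_\theta(JX,Y)\,T$ and $\mathrm{Tor}^W(T,X)=-\tfrac12([T,X]+J[T,JX])$ for all $X,Y\in\Gamma(H)$. Let $R^W(X,Y,Z,V)=g_\theta\big((\nabla^W_X\nabla^W_Y-\nabla^W_Y\nabla^W_X-\nabla^W_{[X,Y]})Z,\,V\big)$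 be the Webster curvature tensor. Suppose that $\theta$ is transversally symmetric, i.e. $[T,X]+J[T,JX]=0$ for all $X\in\Gamma(H)$. Then for all vector fields $X,Y,Z,V$ on $M$ one has $$R^W(X,Y,Z,V)+R^W(Y,Z,X,V)+R^W(Z,X,Y,V)=0,$$ $$R^W(X,Y,Z,V)=R^W(Z,V,X,Y),\qquad R^W(X,JY,JZ,V)=R^W(JX,Y,Z,JV)$$ at every point of $M$. -/

import Mathlib

open Bundle VectorField
open scoped Manifold ContDiff Topology

noncomputable section

namespace CRGeometry

/-! ### Smooth vector fields and one-forms on a manifold -/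

section Forms

variable {n : ℕ} {M : Type*} [TopologicalSpace M] [ChartedSpace (EuclideanSpace ℝ (Fin n)) M]

/-- `X` is a smooth vector field on `M`, i.e. `X ∈ Γ(TM)`. -/
def IsSmoothField [IsManifold (𝓡 n) ∞ M] (X : Π x : M, TangentSpace (𝓡 n) x) : Prop :=
  ContMDiff (𝓡 n) (𝓡 n).tangent ∞ (fun x ↦ (⟨x, X x⟩ : TangentBundle (𝓡 n) M))

/-- `X` is a vector field on `M` that is differentiable at the point `x`. -/
abbrev IsDiffFieldAt [IsManifold (𝓡 n) ∞ M] (X : Π x : M, TangentSpace (𝓡 n) x) (x : M) : Prop :=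
  MDifferentiableAt (𝓡 n) (𝓡 n).tangent (fun y ↦ (⟨y, X y⟩ : TangentBundle (𝓡 n) M)) x

variable (n M) in
/-- A smooth real one-form on `M`: a smooth section of the cotangent bundle. -/
structure OneForm [IsManifold (𝓡 n) ∞ M] where
  /-- the value of the form at each point -/
  toFun : Π x : M, TangentSpace (𝓡 n) x →L[ℝ] ℝ
  smooth : ContMDiff (𝓡 n) ((𝓡 n).prod 𝓘(ℝ, EuclideanSpace ℝ (Fin n) →L[ℝ] ℝ)) ∞
    (fun x ↦ TotalSpace.mk' (EuclideanSpace ℝ (Fin n) →L[ℝ] ℝ)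
      (E := fun x : M ↦ TangentSpace (𝓡 n) x →L[ℝ] Bundle.Trivial M ℝ x) x (toFun x))

namespace OneForm

variable [IsManifold (𝓡 n) ∞ M]

instance : CoeFun (OneForm n M) (fun _ ↦ Π x : M, TangentSpace (𝓡 n) x →L[ℝ] ℝ) :=
  ⟨OneForm.toFun⟩

lemma mdifferentiableAt_apply (α : OneForm n M) {X : Π x : M, TangentSpace (𝓡 n) x} {x : M}
    (hX : IsDiffFieldAt X x) :
    MDifferentiableAt (𝓡 n) 𝓘(ℝ) (fun y ↦ α y (X y)) x := by
  have h := (α.smooth x).mdifferentiableAt (by simp)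
  have h2 := MDifferentiableAt.clm_bundle_apply (F₂ := ℝ) (E₂ := Bundle.Trivial M ℝ) h hX
  rw [mdifferentiableAt_section] at h2
  exact h2

/-- The expression `X(α(Y)) - Y(α(X)) - α([X, Y])`, as a function on `M`. -/
def extDerivAux (α : OneForm n M) (X Y : Π x : M, TangentSpace (𝓡 n) x) (x : M) : ℝ :=
  mvfderiv (𝓡 n) (fun y ↦ α y (Y y)) x (X x) - mvfderiv (𝓡 n) (fun y ↦ α y (X y)) x (Y x)
    - α x (mlieBracket (𝓡 n) X Y x)

lemma extDerivAux_swap (α : OneForm n M) (X Y : Π x : M, TangentSpace (𝓡 n) x) (x : M) :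
    α.extDerivAux X Y x = - α.extDerivAux Y X x := by
  unfold extDerivAux
  rw [mlieBracket_swap_apply, map_neg]
  ring

lemma tensorialAt_left (α : OneForm n M) (x : M) (Y : Π x : M, TangentSpace (𝓡 n) x)
    (_ : IsDiffFieldAt Y x) :
    TensorialAt (𝓡 n) (EuclideanSpace ℝ (Fin n)) (fun X ↦ α.extDerivAux X Y x) x where
  smul {f X} hf hX := by
    have h1 : mvfderiv (𝓡 n) (fun y ↦ α y ((f • X) y)) x
        = f x • mvfderiv (𝓡 n) (fun y ↦ α y (X y)) x
          + α x (X x) • mvfderiv (𝓡 n) f x := by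
      have := mvfderiv_fun_mul hf (α.mdifferentiableAt_apply hX)
      simpa [Pi.smul_apply', smul_eq_mul] using this
    simp only [extDerivAux, h1]
    rw [mlieBracket_smul_left hf hX]
    simp
    ring
  add {X X'} hX hX' := by
    have h1 : mvfderiv (𝓡 n) (fun y ↦ α y ((X + X') y)) x
        = mvfderiv (𝓡 n) (fun y ↦ α y (X y)) x + mvfderiv (𝓡 n) (fun y ↦ α y (X' y)) x := by
      have := mvfderiv_fun_add (α.mdifferentiableAt_apply hX) (α.mdifferentiableAt_apply hX')
      simpa using this
    simp only [extDerivAux, h1]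
    rw [mlieBracket_add_left hX hX']
    simp
    ring

lemma tensorialAt_right (α : OneForm n M) (x : M) (X : Π x : M, TangentSpace (𝓡 n) x)
    (hX : IsDiffFieldAt X x) :
    TensorialAt (𝓡 n) (EuclideanSpace ℝ (Fin n)) (fun Y ↦ α.extDerivAux X Y x) x where
  smul {f Y} hf hY := by
    have := (α.tensorialAt_left x X hX).smul hf hY
    simp only [α.extDerivAux_swap X]
    simp [this]
  add {Y Y'} hY hY' := by
    have := (α.tensorialAt_left x X hX).add hY hY'
    simp only [α.extDerivAux_swap X]
    rw [this]; ring

/-- The exterior derivative `dα` of a one-form, normalised so that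
`dα(X, Y) = X(α(Y)) - Y(α(X)) - α([X, Y])`. -/
def extDeriv (α : OneForm n M) (x : M) :
    TangentSpace (𝓡 n) x →L[ℝ] TangentSpace (𝓡 n) x →L[ℝ] ℝ :=
  TensorialAt.mkHom₂ (fun X Y ↦ α.extDerivAux X Y x) x
    (α.tensorialAt_left x) (α.tensorialAt_right x)

lemma extDeriv_apply (α : OneForm n M) {x : M} {X Y : Π x : M, TangentSpace (𝓡 n) x}
    (hX : IsDiffFieldAt X x) (hY : IsDiffFieldAt Y x) :
    α.extDeriv x (X x) (Y x) =
      mvfderiv (𝓡 n) (fun y ↦ α y (Y y)) x (X x) - mvfderiv (𝓡 n) (fun y ↦ α y (X y)) x (Y x)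
        - α x (mlieBracket (𝓡 n) X Y x) :=
  TensorialAt.mkHom₂_apply (α.tensorialAt_left x) (α.tensorialAt_right x) hX hY

end OneForm

/-- Every tangent vector of a Hausdorff manifold is the value of a smooth vector field, so an
identity between tensors holds on all tangent vectors as soon as it holds on `Γ(TM)`. -/
lemma exists_isSmoothField [IsManifold (𝓡 n) ∞ M] [T2Space M] {x : M}
    (v : TangentSpace (𝓡 n) x) :
    ∃ X : Π y : M, TangentSpace (𝓡 n) y, IsSmoothField X ∧ X x = v := by
  obtain ⟨s, hs, hsm⟩ := FiberBundle.exists_contMDiffOn_extend (k := ∞) (𝓡 n)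
    (EuclideanSpace ℝ (Fin n)) v
  obtain ⟨f, -, hf⟩ := (SmoothBumpFunction.nhds_basis_tsupport (I := 𝓡 n) x).mem_iff.1
    (interior_mem_nhds.2 hs)
  refine ⟨fun y ↦ f y • FiberBundle.extend (EuclideanSpace ℝ (Fin n)) v y, ?_, ?_⟩
  · exact ContMDiffOn.smul_section_of_tsupport f.contMDiff.contMDiffOn isOpen_interior hf
      (hsm.mono interior_subset)
  · simp

end Forms

/-! ### CR structures, pseudo-Hermitian structures and the Reeb vector field -/

section CR

variable (m : ℕ) (M : Type*) [TopologicalSpace M]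
  [ChartedSpace (EuclideanSpace ℝ (Fin (2 * m + 1))) M] [IsManifold (𝓡 (2 * m + 1)) ∞ M]

/-- A CR structure `(H, J)` on a smooth manifold `M` of dimension `2m + 1`. -/
structure CRStructure where
  /-- the distribution `H ⊆ TM` -/
  H : Π x : M, Submodule ℝ (TangentSpace (𝓡 (2 * m + 1)) x)
  /-- `H` is a contact distribution: locally it is the kernel of a nowhere vanishing smooth
  one-form whose exterior derivative is non-degenerate on `H` (in particular `H` is a smooth
  subbundle of codimension one). -/
  contact : ∀ x₀ : M, ∃ α : OneForm (2 * m + 1) M, ∀ᶠ x in 𝓝 x₀, α x ≠ 0 ∧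
    (∀ v, v ∈ H x ↔ α x v = 0) ∧
    (∀ v ∈ H x, (∀ w ∈ H x, α.extDeriv x v w = 0) → v = 0)
  /-- the endomorphism `J` of `H` -/
  J : Π x : M, H x →ₗ[ℝ] H x
  /-- `J` is smooth: it maps `Γ(H)` to `Γ(H)`. -/
  smooth_J : ∀ X : Π x, H x, IsSmoothField (fun x ↦ (X x : TangentSpace (𝓡 (2 * m + 1)) x)) →
    IsSmoothField (fun x ↦ (J x (X x) : TangentSpace (𝓡 (2 * m + 1)) x))
  J_sq : ∀ x (v : H x), J x (J x v) = -v
  /-- `[JX, Y] + [X, JY] ∈ Γ(H)` for `X, Y ∈ Γ(H)`. -/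
  bracket_mem : ∀ X Y : Π x, H x,
    IsSmoothField (fun x ↦ (X x : TangentSpace (𝓡 (2 * m + 1)) x)) →
    IsSmoothField (fun x ↦ (Y x : TangentSpace (𝓡 (2 * m + 1)) x)) → ∀ x,
    mlieBracket (𝓡 (2 * m + 1)) (fun y ↦ (J y (X y) : TangentSpace (𝓡 (2 * m + 1)) y))
        (fun y ↦ (Y y : TangentSpace (𝓡 (2 * m + 1)) y)) x
      + mlieBracket (𝓡 (2 * m + 1)) (fun y ↦ (X y : TangentSpace (𝓡 (2 * m + 1)) y))
        (fun y ↦ (J y (Y y) : TangentSpace (𝓡 (2 * m + 1)) y)) x ∈ H x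
  /-- `J([JX, Y] + [X, JY]) - [JX, JY] + [X, Y] = 0` for `X, Y ∈ Γ(H)`. -/
  integrable : ∀ (X Y : Π x, H x)
    (hX : IsSmoothField (fun x ↦ (X x : TangentSpace (𝓡 (2 * m + 1)) x)))
    (hY : IsSmoothField (fun x ↦ (Y x : TangentSpace (𝓡 (2 * m + 1)) x))) (x : M),
    (J x ⟨_, bracket_mem X Y hX hY x⟩ : TangentSpace (𝓡 (2 * m + 1)) x)
      - mlieBracket (𝓡 (2 * m + 1)) (fun y ↦ (J y (X y) : TangentSpace (𝓡 (2 * m + 1)) y))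
        (fun y ↦ (J y (Y y) : TangentSpace (𝓡 (2 * m + 1)) y)) x
      + mlieBracket (𝓡 (2 * m + 1)) (fun y ↦ (X y : TangentSpace (𝓡 (2 * m + 1)) y))
        (fun y ↦ (Y y : TangentSpace (𝓡 (2 * m + 1)) y)) x = 0

variable {m M}

/-- A pseudo-Hermitian structure on a CR manifold: a nowhere vanishing real one-form `θ` with
`θ|_H = 0`. -/
structure PseudoHermitian (S : CRStructure m M) where
  θ : OneForm (2 * m + 1) M
  ne_zero : ∀ x, θ x ≠ 0
  vanish : ∀ x, ∀ v ∈ S.H x, θ x v = 0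

namespace PseudoHermitian

variable {S : CRStructure m M} (P : PseudoHermitian S)

lemma mem_H_iff (x : M) (v : TangentSpace (𝓡 (2 * m + 1)) x) : v ∈ S.H x ↔ P.θ x v = 0 := by
  refine ⟨P.vanish x v, fun hv ↦ ?_⟩
  obtain ⟨α, hα⟩ := S.contact x
  obtain ⟨-, hH, -⟩ := hα.self_of_nhds
  obtain ⟨w, hw⟩ : ∃ w, P.θ x w ≠ 0 := by
    by_contra! h
    exact P.ne_zero x (ContinuousLinearMap.ext h)
  have hαw : α x w ≠ 0 := fun h ↦ hw (P.vanish x w ((hH w).2 h))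
  have h1 : v - (α x v / α x w) • w ∈ S.H x := by
    rw [hH]
    simp [hαw]
  have h2 := P.vanish x _ h1
  rw [map_sub, map_smul, hv, smul_eq_mul, zero_sub, neg_eq_zero, mul_eq_zero, div_eq_zero_iff] at h2
  rw [hH]
  tauto

/-- The Reeb vector field of a pseudo-Hermitian structure `θ`: the (unique) vector field `T` with
`θ(T) = 1` and `dθ(T, ·) = 0`. -/
structure ReebField where
  toFun : Π x : M, TangentSpace (𝓡 (2 * m + 1)) x
  smooth : IsSmoothField toFun
  theta_eq_one : ∀ x, P.θ x (toFun x) = 1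
  interior_eq_zero : ∀ x v, P.θ.extDeriv x (toFun x) v = 0

instance : CoeFun P.ReebField (fun _ ↦ Π x : M, TangentSpace (𝓡 (2 * m + 1)) x) :=
  ⟨ReebField.toFun⟩

variable {P} (T : P.ReebField)

/-- The projection of `TM` onto `H` along the Reeb vector field. -/
def proj (x : M) : TangentSpace (𝓡 (2 * m + 1)) x →ₗ[ℝ] S.H x where
  toFun v := ⟨v - P.θ x v • T x, by simp [P.mem_H_iff, T.theta_eq_one]⟩
  map_add' v w := by
    ext1
    simp only [map_add, Submodule.coe_add]
    module
  map_smul' c v := by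
    ext1
    simp only [map_smul, smul_eq_mul, RingHom.id_apply, Submodule.coe_smul]
    module

/-- The extension of `J` to `TM` by `J(T) = 0`. -/
def J (x : M) : TangentSpace (𝓡 (2 * m + 1)) x →ₗ[ℝ] TangentSpace (𝓡 (2 * m + 1)) x :=
  (S.H x).subtype ∘ₗ S.J x ∘ₗ proj T x

lemma J_reeb (x : M) : J T x (T x) = 0 := by
  have : proj T x (T x) = 0 := by ext1; simp [proj, T.theta_eq_one]
  simp [J, this]

lemma J_of_mem (x : M) (v : S.H x) : J T x v = S.J x v := by
  have : proj T x v = v := by ext1; simp [proj, P.vanish x v v.2]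
  simp [J, this]

/-- `L_θ = dθ(·, J ·)`. -/
def levi (x : M) (v w : TangentSpace (𝓡 (2 * m + 1)) x) : ℝ :=
  P.θ.extDeriv x v (J T x w)

/-- The metric `g_θ = L_θ + θ ∘ θ`; it may have any signature. -/
def metric (x : M) (v w : TangentSpace (𝓡 (2 * m + 1)) x) : ℝ :=
  levi T x v w + P.θ x v * P.θ x w

/-- `θ` is transversally symmetric (a TSPH structure): its Reeb vector field `T` is a transversal
symmetry of `(H, J)`, i.e. `[T, X] + J[T, JX] = 0` for all `X ∈ Γ(H)`. -/
def IsTransversallySymmetric : Prop :=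
  ∀ X : Π x, S.H x, IsSmoothField (fun x ↦ (X x : TangentSpace (𝓡 (2 * m + 1)) x)) → ∀ x,
    mlieBracket (𝓡 (2 * m + 1)) T (fun y ↦ (X y : TangentSpace (𝓡 (2 * m + 1)) y)) x
      + J T x (mlieBracket (𝓡 (2 * m + 1)) T
        (fun y ↦ (S.J y (X y) : TangentSpace (𝓡 (2 * m + 1)) y)) x) = 0

/-- `∇` is the Tanaka-Webster connection: the smooth connection on `TM` with `∇ g_θ = 0` and
torsion `Tor(X, Y) = L_θ(JX, Y) T`, `Tor(T, X) = -½([T, X] + J[T, JX])` for `X, Y ∈ Γ(H)`. (In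
Mathlib's notation `∇ Y x (X x)` is the value of `∇_X Y` at `x`.) -/
structure IsTanakaWebster
    (nabla : CovariantDerivative (𝓡 (2 * m + 1)) (EuclideanSpace ℝ (Fin (2 * m + 1)))
      (TangentSpace (𝓡 (2 * m + 1)) : M → Type _)) : Prop where
  smooth : CovariantDerivative.ContMDiffCovariantDerivative nabla ∞
  metric_compatible : ∀ X Y Z : Π x : M, TangentSpace (𝓡 (2 * m + 1)) x,
    IsSmoothField X → IsSmoothField Y → IsSmoothField Z → ∀ x,
    mvfderiv (𝓡 (2 * m + 1)) (fun y ↦ metric T y (Y y) (Z y)) x (X x)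
      = metric T x (nabla Y x (X x)) (Z x) + metric T x (Y x) (nabla Z x (X x))
  torsion_horizontal : ∀ x, ∀ v ∈ S.H x, ∀ w ∈ S.H x,
    nabla.torsion x v w = levi T x (J T x v) w • T x
  torsion_reeb : ∀ X : Π x, S.H x,
    IsSmoothField (fun x ↦ (X x : TangentSpace (𝓡 (2 * m + 1)) x)) → ∀ x,
    nabla.torsion x (T x) (X x) = -(1 / 2 : ℝ) •
      (mlieBracket (𝓡 (2 * m + 1)) T (fun y ↦ (X y : TangentSpace (𝓡 (2 * m + 1)) y)) x
        + J T x (mlieBracket (𝓡 (2 * m + 1)) T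
          (fun y ↦ (S.J y (X y) : TangentSpace (𝓡 (2 * m + 1)) y)) x))

end PseudoHermitian

end CR

/-! ### Curvature -/

section Curvature

variable {n : ℕ} {M : Type*} [TopologicalSpace M] [ChartedSpace (EuclideanSpace ℝ (Fin n)) M]
  [IsManifold (𝓡 n) ∞ M]

/-- The curvature operator `R(X, Y)Z = ∇_X ∇_Y Z - ∇_Y ∇_X Z - ∇_[X,Y] Z`. -/
def curvature
    (nabla : CovariantDerivative (𝓡 n) (EuclideanSpace ℝ (Fin n))
      (TangentSpace (𝓡 n) : M → Type _))
    (X Y Z : Π x : M, TangentSpace (𝓡 n) x) (x : M) : TangentSpace (𝓡 n) x :=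
  nabla (fun y ↦ nabla Z y (Y y)) x (X x) - nabla (fun y ↦ nabla Z y (X y)) x (Y x)
    - nabla Z x (mlieBracket (𝓡 n) X Y x)

end Curvature

/-- The curvature tensor `R^W(X, Y, Z, V) = g_θ(R(X, Y)Z, V)` of the connection `∇`. -/
def PseudoHermitian.websterCurvature {m : ℕ} {M : Type*} [TopologicalSpace M]
    [ChartedSpace (EuclideanSpace ℝ (Fin (2 * m + 1))) M] [IsManifold (𝓡 (2 * m + 1)) ∞ M]
    {S : CRStructure m M} {P : PseudoHermitian S} (T : P.ReebField)
    (nabla : CovariantDerivative (𝓡 (2 * m + 1)) (EuclideanSpace ℝ (Fin (2 * m + 1)))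
      (TangentSpace (𝓡 (2 * m + 1)) : M → Type _))
    (X Y Z V : Π x : M, TangentSpace (𝓡 (2 * m + 1)) x) (x : M) : ℝ :=
  metric T x (curvature nabla X Y Z x) (V x)

end CRGeometry

end

/-!
The symmetries of the curvature hold because the Webster connection of a transversally symmetric
structure makes `T`, `J` and `g` parallel and has closed torsion `dθ ⊗ T`.

* Transversal symmetry gives `L_T J = 0`, and `L_T dθ = 0` always holds because `d(dθ) = 0` and
  `dθ(T, ·) = 0`; so `T` is a Killing field (`WebsterCalculus.lie_T_g`). Hence the form
  `g(∇_X T, Y)` is skew. The torsion formula makes it symmetric, and `∇T = 0`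
  (`WebsterCalculus.cov_T`).
* As on a Kähler manifold, `dθ = g(J ·, ·)` is closed and `J` is integrable; since the torsion is a
  multiple of the parallel field `T`, the usual argument gives `∇J = 0`
  (`WebsterCalculus.covJ_eq_zero`).
* In the cyclic sum of `R(X, Y)Z` the torsion contributes only `d(dθ)(X, Y, Z) T = 0`
  (`WebsterCalculus.curv_cyclic`). With the skew symmetries of `R` this yields the pair symmetry
  (`WebsterCalculus.R_pair_symm`), and with `∇J = 0` the compatibility with `J`
  (`WebsterCalculus.R_J_J`).

All of this is algebra in the Lie–Rinehart ring formed by `C^∞(M)` and `Γ(TM)`, and it is carried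
out there, for an abstract `WebsterCalculus`. The analytic input is that smooth fields do form such
a ring: the Lie bracket acts on functions as a commutator (`mvfderiv_mlieBracket`). The passage from
`H` to `TM` uses the splitting `TM = H ⊕ ℝT`, along which every tensor involved is determined by its
values on `H` and on `T`.
-/

namespace CRGeometry

/-! ### Exterior derivative of a one-form over a Lie–Rinehart ring -/

section ExteriorDerivative

variable {A L : Type*} [CommRing A] [LieRing L] [Module A L] [LieRingModule L A]
  [LieRinehartRing A L]

lemma lie_smul_left (f : A) (X Y : L) : ⁅f • X, Y⁆ = f • ⁅X, Y⁆ - ⁅Y, f⁆ • X := by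
  rw [← lie_skew, LieRinehartRing.leibniz_smul_right, ← lie_skew X Y]
  module

lemma lie_ring_one (X : L) : ⁅X, (1 : A)⁆ = 0 := by
  have h := LieRinehartRing.leibniz_mul_right X (1 : A) (1 : A)
  simpa using h

/-- The exterior derivative of a one-form on a Lie–Rinehart ring, normalised so that
`dθ(X, Y) = X(θ(Y)) - Y(θ(X)) - θ([X, Y])`. -/
def lieExtDeriv (θ : L →ₗ[A] A) : L →ₗ[A] L →ₗ[A] A :=
  LinearMap.mk₂ A (fun X Y ↦ ⁅X, θ Y⁆ - ⁅Y, θ X⁆ - θ ⁅X, Y⁆)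
    (fun X X' Y ↦ by simp only [map_add, add_lie, lie_add]; ring)
    (fun f X Y ↦ by
      simp only [map_smul, map_sub, lie_smul_left, LieRinehartRing.lie_smul_eq_mul, smul_eq_mul,
        LieRinehartRing.leibniz_mul_right]
      ring)
    (fun X Y Y' ↦ by simp only [map_add, add_lie, lie_add]; ring)
    (fun f X Y ↦ by
      simp only [map_smul, map_add, LieRinehartRing.leibniz_smul_right,
        LieRinehartRing.lie_smul_eq_mul, smul_eq_mul, LieRinehartRing.leibniz_mul_right]
      ring)

lemma lieExtDeriv_apply (θ : L →ₗ[A] A) (X Y : L) :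
    lieExtDeriv θ X Y = ⁅X, θ Y⁆ - ⁅Y, θ X⁆ - θ ⁅X, Y⁆ := rfl

lemma lieExtDeriv_swap (θ : L →ₗ[A] A) (X Y : L) :
    lieExtDeriv θ X Y = -lieExtDeriv θ Y X := by
  rw [lieExtDeriv_apply, lieExtDeriv_apply, ← lie_skew Y X, map_neg]
  ring

/-- `d(dθ) = 0`. -/
lemma lieExtDeriv_closed (θ : L →ₗ[A] A) (X Y Z : L) :
    ⁅X, lieExtDeriv θ Y Z⁆ + ⁅Y, lieExtDeriv θ Z X⁆ + ⁅Z, lieExtDeriv θ X Y⁆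
      = lieExtDeriv θ ⁅X, Y⁆ Z + lieExtDeriv θ ⁅Y, Z⁆ X + lieExtDeriv θ ⁅Z, X⁆ Y := by
  have h := congrArg θ (lie_jacobi X Y Z)
  rw [← lie_skew X ⁅Y, Z⁆, ← lie_skew Y ⁅Z, X⁆, ← lie_skew Z ⁅X, Y⁆] at h
  simp only [map_add, map_neg, map_zero] at h
  simp only [lieExtDeriv_apply, lie_sub, lie_lie (_ : L) (_ : L) (_ : A)]
  linear_combination -h

end ExteriorDerivative

/-! ### The transversally symmetric Webster calculus over a Lie–Rinehart ring -/

/-- The pseudo-Hermitian calculus of a transversally symmetric structure, for abstract "functions"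
`A` and "vector fields" `L`: the form `θ`, its Reeb field `T`, the extended complex structure `J`
and a metric connection `cov X Y = ∇_X Y`. The distribution `H` is the kernel of `θ`. The torsion is
stated as `dθ(J ·, J ·) T`, the form in which the Levi form `L_θ(J ·, ·)` gives it; it equals
`dθ ⊗ T` by `Ω_J_J`. -/
structure WebsterCalculus (A L : Type*) [CommRing A] [LieRing L] [Module A L] [LieRingModule L A]
    [LieRinehartRing A L] where
  /-- the one-form `θ` -/
  θ : L →ₗ[A] A
  /-- the Reeb field -/
  T : L
  /-- the complex structure of `H`, extended by `J T = 0` -/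
  J : L →ₗ[A] L
  /-- the connection, `cov X Y = ∇_X Y` -/
  cov : L →ₗ[A] L →+ L
  two_torsion : ∀ f : A, f + f = 0 → f = 0
  θ_T : θ T = 1
  θ_J : ∀ X, θ (J X) = 0
  J_T : J T = 0
  J_J : ∀ X, J (J X) = -X + θ X • T
  interior_T : ∀ X, lieExtDeriv θ T X = 0
  bracket_mem : ∀ X Y, θ X = 0 → θ Y = 0 → θ (⁅J X, Y⁆ + ⁅X, J Y⁆) = 0
  integrable : ∀ X Y, θ X = 0 → θ Y = 0 →
    J (⁅J X, Y⁆ + ⁅X, J Y⁆) - ⁅J X, J Y⁆ + ⁅X, Y⁆ = 0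
  symmetric : ∀ X, θ X = 0 → ⁅T, X⁆ + J ⁅T, J X⁆ = 0
  nondegenerate : ∀ X, (∀ Y, lieExtDeriv θ X (J Y) + θ X * θ Y = 0) → X = 0
  cov_smul : ∀ (f : A) (X Y : L), cov X (f • Y) = f • cov X Y + ⁅X, f⁆ • Y
  metric_compatible : ∀ X Y Z, ⁅X, lieExtDeriv θ Y (J Z) + θ Y * θ Z⁆
    = lieExtDeriv θ (cov X Y) (J Z) + θ (cov X Y) * θ Z
      + (lieExtDeriv θ Y (J (cov X Z)) + θ Y * θ (cov X Z))
  torsion : ∀ X Y, cov X Y - cov Y X - ⁅X, Y⁆ = lieExtDeriv θ (J X) (J Y) • T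

namespace WebsterCalculus

variable {A L : Type*} [CommRing A] [LieRing L] [Module A L] [LieRingModule L A]
  [LieRinehartRing A L] (W : WebsterCalculus A L)

/-- The two-form `dθ`. -/
abbrev Ω : L →ₗ[A] L →ₗ[A] A := lieExtDeriv W.θ

/-- The metric `dθ(·, J ·) + θ ⊗ θ`. -/
def g (X Y : L) : A := W.Ω X (W.J Y) + W.θ X * W.θ Y

/-- The derivative `(∇_X J) Y`. -/
def covJ (X Y : L) : L := W.cov X (W.J Y) - W.J (W.cov X Y)

/-- The curvature operator `R(X, Y) Z`. -/
def curv (X Y Z : L) : L := W.cov X (W.cov Y Z) - W.cov Y (W.cov X Z) - W.cov ⁅X, Y⁆ Z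

/-- The curvature tensor `R(X, Y, Z, V) = g(R(X, Y) Z, V)`. -/
def R (X Y Z V : L) : A := W.g (W.curv X Y Z) V

/-! ### Linear algebra of the metric -/

lemma Ω_T_right (X : L) : W.Ω X W.T = 0 := by
  rw [Ω, lieExtDeriv_swap, W.interior_T, neg_zero]

lemma θ_sub_smul (X : L) : W.θ (X - W.θ X • W.T) = 0 := by
  simp [W.θ_T]

lemma J_sub_smul (X : L) (f : A) : W.J (X - f • W.T) = W.J X := by
  simp [W.J_T]

/-- `J` is skew for `dθ`: on `H` this is the condition `[JX, Y] + [X, JY] ∈ H`, and both sides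
vanish on `T`. -/
lemma Ω_J_left (X Y : L) : W.Ω (W.J X) Y = -W.Ω X (W.J Y) := by
  have key : ∀ X Y, W.θ X = 0 → W.θ Y = 0 → W.Ω (W.J X) Y = -W.Ω X (W.J Y) := by
    intro X Y hX hY
    have h := W.bracket_mem X Y hX hY
    rw [map_add] at h
    simp only [Ω, lieExtDeriv_apply, W.θ_J, hX, hY, lie_zero]
    linear_combination -h
  have h := key _ _ (W.θ_sub_smul X) (W.θ_sub_smul Y)
  simpa [W.J_T, W.interior_T, W.Ω_T_right] using h

lemma Ω_J_J (X Y : L) : W.Ω (W.J X) (W.J Y) = W.Ω X Y := by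
  simp [Ω_J_left, W.J_J, W.Ω_T_right]

lemma g_symm (X Y : L) : W.g X Y = W.g Y X := by
  rw [g, g, Ω, lieExtDeriv_swap, W.Ω_J_left]
  ring

@[simp] lemma g_add_left (X X' Y : L) : W.g (X + X') Y = W.g X Y + W.g X' Y := by
  simp [g]; ring

@[simp] lemma g_sub_left (X X' Y : L) : W.g (X - X') Y = W.g X Y - W.g X' Y := by
  simp [g]; ring

@[simp] lemma g_neg_left (X Y : L) : W.g (-X) Y = -W.g X Y := by
  simp [g]; ring

@[simp] lemma g_zero_left (Y : L) : W.g 0 Y = 0 := by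
  simp [g]

@[simp] lemma g_add_right (X Y Y' : L) : W.g X (Y + Y') = W.g X Y + W.g X Y' := by
  simp [g]; ring

lemma g_T_left (X : L) : W.g W.T X = W.θ X := by
  simp [g, W.interior_T, W.θ_T]

lemma g_J_left (X Y : L) : W.g (W.J X) Y = W.Ω X Y := by
  simp [g, W.θ_J, Ω_J_J]

lemma g_J_right (X Y : L) : W.g X (W.J Y) = -W.Ω X Y := by
  rw [g_symm, g_J_left, Ω, lieExtDeriv_swap]

lemma eq_zero_of_g (X : L) (h : ∀ Y, W.g X Y = 0) : X = 0 := W.nondegenerate X h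

lemma lie_g (X Y Z : L) : ⁅X, W.g Y Z⁆ = W.g (W.cov X Y) Z + W.g Y (W.cov X Z) :=
  W.metric_compatible X Y Z

/-! ### The Reeb field is a parallel infinitesimal symmetry -/

lemma θ_lie_T (X : L) : W.θ ⁅W.T, X⁆ = ⁅W.T, W.θ X⁆ := by
  have h := W.interior_T X
  rw [lieExtDeriv_apply, W.θ_T, lie_ring_one] at h
  linear_combination -h

/-- Applying `J` to `[T, X] + J[T, JX] = 0` gives `L_T J = 0`; the `T`-component of `[T, JX]`
vanishes because `dθ(T, JX) = 0`. -/
lemma lie_T_J (X : L) : ⁅W.T, W.J X⁆ = W.J ⁅W.T, X⁆ := by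
  have h := W.symmetric _ (W.θ_sub_smul X)
  rw [W.J_sub_smul] at h
  have h2 := congrArg W.J h
  rw [map_add, W.J_J, W.θ_lie_T, W.θ_J, lie_zero, zero_smul, add_zero, map_zero, lie_sub,
    LieRinehartRing.leibniz_smul_right, lie_self, smul_zero, zero_add, J_sub_smul] at h2
  exact (add_neg_eq_zero.1 h2).symm

/-- `L_T dθ = 0`, by Cartan's formula. -/
lemma lie_T_Ω (X Y : L) : ⁅W.T, W.Ω X Y⁆ = W.Ω ⁅W.T, X⁆ Y + W.Ω X ⁅W.T, Y⁆ := by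
  have h := lieExtDeriv_closed W.θ W.T X Y
  have h1 := W.Ω_T_right Y
  have h2 := W.Ω_T_right ⁅X, Y⁆
  rw [h1, h2, W.interior_T, ← lie_skew Y W.T, map_neg, LinearMap.neg_apply, lie_zero, lie_zero] at h
  linear_combination h - lieExtDeriv_swap W.θ X ⁅W.T, Y⁆

/-- `T` is a Killing field. -/
lemma lie_T_g (X Y : L) : ⁅W.T, W.g X Y⁆ = W.g ⁅W.T, X⁆ Y + W.g X ⁅W.T, Y⁆ := by
  simp only [g, lie_add, lie_T_Ω, lie_T_J, θ_lie_T, LieRinehartRing.leibniz_mul_right, smul_eq_mul]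
  ring

lemma cov_sub_cov (X Y : L) : W.cov X Y - W.cov Y X = ⁅X, Y⁆ + W.Ω X Y • W.T := by
  rw [← W.Ω_J_J, ← W.torsion]
  abel

lemma lie_eq_cov (X Y : L) : ⁅X, Y⁆ = W.cov X Y - W.cov Y X - W.Ω X Y • W.T := by
  rw [W.cov_sub_cov]
  abel

/-- The form `g(∇_X T, Y)` is symmetric by the torsion formula and skew because `T` is a Killing
field, so `T` is parallel. -/
lemma cov_T (X : L) : W.cov X W.T = 0 := by
  have hθ : ∀ X Y, ⁅X, W.θ Y⁆ = W.g (W.cov X W.T) Y + W.θ (W.cov X Y) := by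
    intro X Y
    rw [← W.g_T_left, W.lie_g, W.g_T_left]
  have hT : ∀ X, W.cov W.T X = W.cov X W.T + ⁅W.T, X⁆ := by
    intro X
    have := W.cov_sub_cov W.T X
    rw [W.interior_T, zero_smul, add_zero] at this
    rw [← this]; abel
  refine W.eq_zero_of_g _ fun Y ↦ W.two_torsion _ ?_
  have h1 : W.g (W.cov X W.T) Y = W.g (W.cov Y W.T) X := by
    have h := congrArg W.θ (W.cov_sub_cov X Y)
    simp only [map_sub, map_add, map_smul, smul_eq_mul, W.θ_T, Ω, lieExtDeriv_apply] at h
    linear_combination hθ Y X - hθ X Y - h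
  have h2 : W.g (W.cov X W.T) Y + W.g (W.cov Y W.T) X = 0 := by
    have h := W.lie_g W.T X Y
    rw [W.lie_T_g, hT, hT, W.g_add_left, W.g_add_right, W.g_symm X (W.cov Y W.T)] at h
    linear_combination -h
  linear_combination h2 + h1

lemma θ_cov (X Y : L) : W.θ (W.cov X Y) = ⁅X, W.θ Y⁆ := by
  rw [← W.g_T_left Y, W.lie_g, W.cov_T, W.g_zero_left, W.g_T_left, zero_add]

lemma cov_T_left (X : L) : W.cov W.T X = ⁅W.T, X⁆ := by
  have h := W.cov_sub_cov W.T X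
  rwa [W.interior_T, zero_smul, add_zero, W.cov_T, sub_zero] at h

/-! ### The complex structure is parallel -/

lemma covJ_sub_smul_left (f : A) (X Y : L) : W.covJ (X - f • W.T) Y = W.covJ X Y := by
  simp [covJ, W.cov_T_left, W.lie_T_J]

lemma covJ_sub_smul_right (f : A) (X Y : L) : W.covJ X (Y - f • W.T) = W.covJ X Y := by
  simp [covJ, W.cov_smul, W.cov_T, W.J_T]

lemma covJ_neg_right (X Y : L) : W.covJ X (-Y) = -W.covJ X Y := by
  simp only [covJ, map_neg]
  abel

/-- The derivative of `dθ = g(J ·, ·)` along a field. -/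
lemma lie_Ω (X Y Z : L) :
    ⁅X, W.Ω Y Z⁆ = W.g (W.covJ X Y) Z + W.Ω (W.cov X Y) Z + W.Ω Y (W.cov X Z) := by
  rw [← W.g_J_left, W.lie_g, covJ, W.g_sub_left, W.g_J_left, W.g_J_left]
  ring

lemma g_covJ_skew (X Y Z : L) : W.g (W.covJ X Y) Z = -W.g (W.covJ X Z) Y := by
  have h := W.lie_Ω X Z Y
  rw [Ω, lieExtDeriv_swap, lie_neg, W.lie_Ω, ← Ω] at h
  linear_combination -h - lieExtDeriv_swap W.θ Y (W.cov X Z)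
    - lieExtDeriv_swap W.θ (W.cov X Y) Z

lemma covJ_J (X Y : L) : W.covJ X (W.J Y) = -W.J (W.covJ X Y) := by
  simp [covJ, W.J_J, W.cov_smul, W.cov_T, W.θ_cov]

lemma g_covJ_J (X Y Z : L) : W.g (W.covJ X (W.J Y)) Z = W.g (W.covJ X Y) (W.J Z) := by
  rw [covJ_J, g_neg_left, g_J_left, g_J_right]

/-- `dΩ = 0` in terms of the connection. -/
lemma g_covJ_cyclic (X Y Z : L) :
    W.g (W.covJ X Y) Z + W.g (W.covJ Y Z) X + W.g (W.covJ Z X) Y = 0 := by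
  have h := lieExtDeriv_closed W.θ X Y Z
  rw [← Ω, W.lie_Ω, W.lie_Ω, W.lie_Ω, W.lie_eq_cov, W.lie_eq_cov, W.lie_eq_cov] at h
  simp only [map_sub, map_smul, LinearMap.sub_apply, LinearMap.smul_apply, W.interior_T, smul_zero,
    Ω] at h
  linear_combination h - lieExtDeriv_swap W.θ (W.cov X Z) Y - lieExtDeriv_swap W.θ (W.cov Y X) Z
    - lieExtDeriv_swap W.θ (W.cov Z Y) X

/-- Integrability in terms of the connection. -/
lemma g_covJ_integrable (X Y Z : L) :
    W.g (W.covJ (W.J X) Y) Z + W.g (W.covJ X Y) (W.J Z)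
      = W.g (W.covJ (W.J Y) X) Z + W.g (W.covJ Y X) (W.J Z) := by
  have key : ∀ X Y, W.θ X = 0 → W.θ Y = 0 →
      W.covJ (W.J X) Y - W.J (W.covJ X Y) = W.covJ (W.J Y) X - W.J (W.covJ Y X) := by
    intro X Y hX hY
    have h := W.integrable X Y hX hY
    simp only [W.lie_eq_cov, map_add, map_sub, map_smul, W.J_T, W.Ω_J_J, smul_zero, sub_zero] at h
    simp only [covJ, map_sub, W.J_J, W.θ_cov, hX, hY, lie_zero, zero_smul, add_zero]
    rw [← sub_eq_zero, ← neg_eq_zero, ← h]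
    abel
  have h := key _ _ (W.θ_sub_smul X) (W.θ_sub_smul Y)
  simp only [J_sub_smul, covJ_sub_smul_left, covJ_sub_smul_right] at h
  have h2 := congrArg (W.g · Z) h
  simp only [g_sub_left, W.g_J_left] at h2
  rw [W.g_J_right, W.g_J_right]
  linear_combination h2

/-- `∇J = 0`. Integrability and `J² = -1` make `B(X, Y, Z) = g((∇_X J)Y, Z)` change sign when `J`
is moved between its first two arguments; with the cyclic identity, this forces `B` to vanish. -/
lemma covJ_eq_zero (X Y : L) : W.covJ X Y = 0 := by
  -- The left-hand side is symmetric in `X`, `Y` and skew in `Y`, `Z`, and such a trilinear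
  -- form is zero.
  have hC : ∀ X Y Z, W.g (W.covJ (W.J X) Y) Z + W.g (W.covJ X Y) (W.J Z) = 0 := by
    have skew : ∀ X Y Z, W.g (W.covJ (W.J X) Y) Z + W.g (W.covJ X Y) (W.J Z)
        = -(W.g (W.covJ (W.J X) Z) Y + W.g (W.covJ X Z) (W.J Y)) := by
      intro X Y Z
      rw [W.g_covJ_skew _ Y, W.g_covJ_skew X Y, W.g_covJ_J]
      ring
    intro X Y Z
    refine W.two_torsion _ ?_
    linear_combination skew X Y Z - W.g_covJ_integrable X Z Y - skew Z X Y
      + W.g_covJ_integrable Z Y X + skew Y Z X + W.g_covJ_integrable X Y Z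
  have hJ : ∀ X Y Z, W.g (W.covJ X (W.J Y)) Z = 0 := by
    intro X Y Z
    refine W.two_torsion _ ?_
    -- Adding the two cyclic identities cancels the terms differentiating along `Y` and `Z`.
    have c1 := W.g_covJ_cyclic X (W.J Y) Z
    have c2 := W.g_covJ_cyclic X Y (W.J Z)
    have a1 := hC Y Z X
    have a2 := hC Z X Y
    have b1 := W.g_covJ_J X Y Z
    have b2 := W.g_covJ_J Y Z X
    linear_combination c1 + c2 - a1 - a2 + b1 - b2
  refine W.eq_zero_of_g _ fun Z ↦ ?_
  have h := hJ X (W.J Y) Z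
  rwa [W.J_J, neg_add_eq_sub, ← neg_sub, covJ_neg_right, covJ_sub_smul_right, g_neg_left,
    neg_eq_zero] at h

lemma cov_J (X Y : L) : W.cov X (W.J Y) = W.J (W.cov X Y) :=
  sub_eq_zero.1 (W.covJ_eq_zero X Y)

/-! ### Curvature identities -/

lemma curv_swap (X Y Z : L) : W.curv Y X Z = -W.curv X Y Z := by
  simp only [curv, ← lie_skew X Y, map_neg, AddMonoidHom.neg_apply]
  abel

lemma R_swap_left (X Y Z V : L) : W.R Y X Z V = -W.R X Y Z V := by
  rw [R, curv_swap, g_neg_left, R]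

/-- The curvature of a metric connection is skew in its last two arguments. -/
lemma R_swap_right (X Y Z V : L) : W.R X Y V Z = -W.R X Y Z V := by
  have h := lie_lie X Y (W.g Z V)
  simp only [W.lie_g, lie_add] at h
  simp only [R, curv, g_sub_left]
  linear_combination -h + W.g_symm (W.cov X (W.cov Y V)) Z - W.g_symm (W.cov Y (W.cov X V)) Z
    - W.g_symm (W.cov ⁅X, Y⁆ V) Z

/-- The first Bianchi identity: the torsion `dθ ⊗ T` contributes only `d(dθ) T = 0`. -/
lemma curv_cyclic (X Y Z : L) : W.curv X Y Z + W.curv Y Z X + W.curv Z X Y = 0 := by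
  have key : ∀ X Y Z, W.cov X (W.cov Y Z) - W.cov X (W.cov Z Y) - W.cov ⁅Y, Z⁆ X
      = ⁅X, ⁅Y, Z⁆⁆ + (⁅X, W.Ω Y Z⁆ - W.Ω ⁅Y, Z⁆ X) • W.T := by
    intro X Y Z
    rw [← map_sub, W.cov_sub_cov, map_add, W.cov_smul, W.cov_T, smul_zero, zero_add,
      add_sub_right_comm, W.cov_sub_cov, Ω, lieExtDeriv_swap W.θ X]
    module
  have h := lieExtDeriv_closed W.θ X Y Z
  have hs : W.curv X Y Z + W.curv Y Z X + W.curv Z X Y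
      = (⁅X, ⁅Y, Z⁆⁆ + ⁅Y, ⁅Z, X⁆⁆ + ⁅Z, ⁅X, Y⁆⁆)
        + ((⁅X, W.Ω Y Z⁆ - W.Ω ⁅Y, Z⁆ X) + (⁅Y, W.Ω Z X⁆ - W.Ω ⁅Z, X⁆ Y)
          + (⁅Z, W.Ω X Y⁆ - W.Ω ⁅X, Y⁆ Z)) • W.T := by
    simp only [curv]
    linear_combination (norm := module) key X Y Z + key Y Z X + key Z X Y
  rw [hs, lie_jacobi, zero_add]
  have : (⁅X, W.Ω Y Z⁆ - W.Ω ⁅Y, Z⁆ X) + (⁅Y, W.Ω Z X⁆ - W.Ω ⁅Z, X⁆ Y)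
          + (⁅Z, W.Ω X Y⁆ - W.Ω ⁅X, Y⁆ Z) = 0 := by linear_combination h
  rw [this, zero_smul]

lemma R_cyclic (X Y Z V : L) : W.R X Y Z V + W.R Y Z X V + W.R Z X Y V = 0 := by
  simp only [R, ← g_add_left, curv_cyclic, g_zero_left]

/-- Pair symmetry follows from the cyclic identity and the two skew symmetries: an alternating sum
of four cyclic identities leaves `2 R(X, Y, Z, V) - 2 R(Z, V, X, Y)`. -/
lemma R_pair_symm (X Y Z V : L) : W.R X Y Z V = W.R Z V X Y := by
  rw [← sub_eq_zero]
  refine W.two_torsion _ ?_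
  have h1 := W.R_cyclic X Y Z V
  have h2 := W.R_cyclic Y Z V X
  have h3 := W.R_cyclic Z V X Y
  have h4 := W.R_cyclic V X Y Z
  rw [W.R_swap_left X Z] at h1
  rw [W.R_swap_right Y Z X V, W.R_swap_right Z V X Y, W.R_swap_left Y V, W.R_swap_right Y V X Z]
    at h2
  rw [W.R_swap_left X V, W.R_swap_right X V Y Z, W.R_swap_right X Z Y V] at h3
  rw [W.R_swap_left X V, W.R_swap_right X Y Z V] at h4
  linear_combination h1 + h2 - h3 - h4

lemma curv_J (X Y Z : L) : W.curv X Y (W.J Z) = W.J (W.curv X Y Z) := by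
  simp only [curv, cov_J, map_sub]

lemma R_J_right (X Y Z V : L) : W.R X Y (W.J Z) V = -W.R X Y Z (W.J V) := by
  rw [R, R, curv_J, g_J_left, g_J_right, neg_neg]

/-- `R(X, Y)` commutes with the skew endomorphism `J`, so moving `J` from one argument of the last
pair to the other changes the sign; by pair symmetry the same holds in the first pair. -/
lemma R_J_J (X Y Z V : L) : W.R X (W.J Y) (W.J Z) V = W.R (W.J X) Y Z (W.J V) := by
  have h : W.R (W.J X) Y Z (W.J V) = -W.R X (W.J Y) Z (W.J V) := by
    rw [W.R_pair_symm, R_J_right, W.R_pair_symm]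
  rw [h, R_J_right]

end WebsterCalculus

/-! ### The Lie bracket of vector fields as a commutator -/

lemma mlieBracket_eq_lieBracket {E : Type*} [NormedAddCommGroup E] [NormedSpace ℝ E]
    (V W : Π x : E, TangentSpace 𝓘(ℝ, E) x) (x : E) :
    mlieBracket 𝓘(ℝ, E) V W x = lieBracket ℝ V W x := by
  rw [← mlieBracketWithin_univ]
  exact (congrFun mlieBracketWithin_eq_lieBracketWithin x).trans
    (congrFun lieBracketWithin_univ x)

lemma fderiv_lieBracket_apply {E : Type*} [NormedAddCommGroup E] [NormedSpace ℝ E]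
    {f : E → ℝ} {V W : E → E} {z : E} (hf : ContDiffAt ℝ 2 f z)
    (hV : DifferentiableAt ℝ V z) (hW : DifferentiableAt ℝ W z) :
    fderiv ℝ f z (lieBracket ℝ V W z)
      = fderiv ℝ (fun y ↦ fderiv ℝ f y (W y)) z (V z)
        - fderiv ℝ (fun y ↦ fderiv ℝ f y (V y)) z (W z) := by
  have hd : DifferentiableAt ℝ (fderiv ℝ f) z :=
    (hf.fderiv_right (m := 1) (by norm_num)).differentiableAt (by simp)
  have hs : fderiv ℝ (fderiv ℝ f) z (V z) (W z) = fderiv ℝ (fderiv ℝ f) z (W z) (V z) :=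
    (hf.isSymmSndFDerivAt (by simp)).eq _ _
  rw [fderiv_clm_apply hd hW, fderiv_clm_apply hd hV]
  simp [lieBracket, hs]

section Commutator

variable {n : ℕ} {M : Type*} [TopologicalSpace M] [ChartedSpace (EuclideanSpace ℝ (Fin n)) M]
  [IsManifold (𝓡 n) ∞ M]

/-- Directional derivatives along a vector field, computed in a chart. -/
lemma mvfderiv_eq_fderiv_chart {f : M → ℝ} (x : M) {z : EuclideanSpace ℝ (Fin n)}
    (hz : z ∈ (extChartAt (𝓡 n) x).target)
    (hf : MDifferentiableAt (𝓡 n) 𝓘(ℝ) f ((extChartAt (𝓡 n) x).symm z))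
    (V : Π x : M, TangentSpace (𝓡 n) x) :
    mvfderiv (𝓡 n) f ((extChartAt (𝓡 n) x).symm z) (V ((extChartAt (𝓡 n) x).symm z))
      = fderiv ℝ (f ∘ (extChartAt (𝓡 n) x).symm) z
        (mpullback 𝓘(ℝ, EuclideanSpace ℝ (Fin n)) (𝓡 n) (extChartAt (𝓡 n) x).symm V z) := by
  have hinv := isInvertible_mfderivWithin_extChartAt_symm (I := 𝓡 n) hz
  have hψ : MDifferentiableAt 𝓘(ℝ, EuclideanSpace ℝ (Fin n)) (𝓡 n)
      (extChartAt (𝓡 n) x).symm z := by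
    have := mdifferentiableWithinAt_extChartAt_symm (I := 𝓡 n) hz
    simpa [mdifferentiableWithinAt_univ] using this
  rw [ModelWithCorners.range_eq_univ, mfderivWithin_univ] at hinv
  rw [← mfderiv_eq_fderiv, mfderiv_comp z hf hψ, mpullback_apply]
  change _ = mfderiv (𝓡 n) 𝓘(ℝ) f _ (mfderiv 𝓘(ℝ, EuclideanSpace ℝ (Fin n)) (𝓡 n)
      (extChartAt (𝓡 n) x).symm z _)
  rw [hinv.self_apply_inverse]
  rfl

lemma contMDiff_mvfderiv_apply {f : M → ℝ} {V : Π x : M, TangentSpace (𝓡 n) x}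
    (hf : ContMDiff (𝓡 n) 𝓘(ℝ) ∞ f) (hV : IsSmoothField V) :
    ContMDiff (𝓡 n) 𝓘(ℝ) ∞ (fun y ↦ mvfderiv (𝓡 n) f y (V y)) :=
  (contMDiff_snd_tangentBundle_modelSpace ℝ 𝓘(ℝ)).comp
    ((hf.contMDiff_tangentMap (m := ∞) (by simp)).comp hV)

/-- The Lie bracket of vector fields acts on functions as the commutator. -/
lemma mvfderiv_mlieBracket {f : M → ℝ} {V W : Π x : M, TangentSpace (𝓡 n) x}
    (hf : ContMDiff (𝓡 n) 𝓘(ℝ) ∞ f) (hV : IsSmoothField V) (hW : IsSmoothField W) (x : M) :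
    mvfderiv (𝓡 n) f x (mlieBracket (𝓡 n) V W x)
      = mvfderiv (𝓡 n) (fun y ↦ mvfderiv (𝓡 n) f y (W y)) x (V x)
        - mvfderiv (𝓡 n) (fun y ↦ mvfderiv (𝓡 n) f y (V y)) x (W x) := by
  have hx : (extChartAt (𝓡 n) x).symm (extChartAt (𝓡 n) x x) = x := extChartAt_to_inv x
  have hxt := mem_extChartAt_target (I := 𝓡 n) x
  have hsmooth : ∀ {V : Π x : M, TangentSpace (𝓡 n) x}, IsSmoothField V →
      ContDiffAt ℝ ∞ (mpullback 𝓘(ℝ, EuclideanSpace ℝ (Fin n)) (𝓡 n) (extChartAt (𝓡 n) x).symm V)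
        (extChartAt (𝓡 n) x x) := by
    intro V hV
    have h := contMDiffWithinAt_mpullbackWithin_extChartAt_symm (n := ∞) (m := ∞)
      (s := Set.univ) (x := x) (hV x).contMDiffWithinAt uniqueMDiffOn_univ (Set.mem_univ x)
      (by simp)
    rw [contMDiffWithinAt_vectorSpace_iff_contDiffWithinAt, ModelWithCorners.range_eq_univ,
      mpullbackWithin_univ, Set.preimage_univ, Set.inter_univ] at h
    exact h.contDiffAt (extChartAt_target_mem_nhds x)
  have hchart : ∀ {h : M → ℝ}, ContMDiff (𝓡 n) 𝓘(ℝ) ∞ h → ∀ U : Π x : M, TangentSpace (𝓡 n) x,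
      ∀ z ∈ (extChartAt (𝓡 n) x).target,
      mvfderiv (𝓡 n) h ((extChartAt (𝓡 n) x).symm z) (U ((extChartAt (𝓡 n) x).symm z))
      = fderiv ℝ (h ∘ (extChartAt (𝓡 n) x).symm) z
        (mpullback 𝓘(ℝ, EuclideanSpace ℝ (Fin n)) (𝓡 n) (extChartAt (𝓡 n) x).symm U z) :=
    fun hh U z hz ↦ mvfderiv_eq_fderiv_chart x hz (hh.mdifferentiableAt (by simp)) U
  have hpt : ∀ {h : M → ℝ}, ContMDiff (𝓡 n) 𝓘(ℝ) ∞ h → ∀ U : Π x : M, TangentSpace (𝓡 n) x,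
      mvfderiv (𝓡 n) h x (U x) = fderiv ℝ (h ∘ (extChartAt (𝓡 n) x).symm) (extChartAt (𝓡 n) x x)
        (mpullback 𝓘(ℝ, EuclideanSpace ℝ (Fin n)) (𝓡 n) (extChartAt (𝓡 n) x).symm U
          (extChartAt (𝓡 n) x x)) := by
    intro h hh U
    have := hchart hh U _ hxt
    rwa [hx] at this
  have hsecond : ∀ {U U' : Π x : M, TangentSpace (𝓡 n) x}, IsSmoothField U →
      mvfderiv (𝓡 n) (fun y ↦ mvfderiv (𝓡 n) f y (U y)) x (U' x)
      = fderiv ℝ (fun z ↦ fderiv ℝ (f ∘ (extChartAt (𝓡 n) x).symm) z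
          (mpullback 𝓘(ℝ, EuclideanSpace ℝ (Fin n)) (𝓡 n) (extChartAt (𝓡 n) x).symm U z))
          (extChartAt (𝓡 n) x x)
        (mpullback 𝓘(ℝ, EuclideanSpace ℝ (Fin n)) (𝓡 n) (extChartAt (𝓡 n) x).symm U'
          (extChartAt (𝓡 n) x x)) := by
    intro U U' hU
    rw [hpt (contMDiff_mvfderiv_apply hf hU)]
    congr 1
    refine Filter.EventuallyEq.fderiv_eq ?_
    filter_upwards [extChartAt_target_mem_nhds (I := 𝓡 n) x] with z hz
    exact hchart hf U z hz
  have hF : ContDiffAt ℝ 2 (f ∘ (extChartAt (𝓡 n) x).symm) (extChartAt (𝓡 n) x x) := by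
    have h := (hf.contMDiffOn (s := Set.univ)).comp (contMDiffOn_extChartAt_symm (n := ∞) x)
      (fun _ _ ↦ Set.mem_univ _)
    exact ((contMDiffOn_iff_contDiffOn.1 h).contDiffAt (extChartAt_target_mem_nhds x)).of_le
      (by norm_cast)
  have hb : mpullback 𝓘(ℝ, EuclideanSpace ℝ (Fin n)) (𝓡 n) (extChartAt (𝓡 n) x).symm
      (mlieBracket (𝓡 n) V W) (extChartAt (𝓡 n) x x)
      = lieBracket ℝ
        (mpullback 𝓘(ℝ, EuclideanSpace ℝ (Fin n)) (𝓡 n) (extChartAt (𝓡 n) x).symm V)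
        (mpullback 𝓘(ℝ, EuclideanSpace ℝ (Fin n)) (𝓡 n) (extChartAt (𝓡 n) x).symm W)
        (extChartAt (𝓡 n) x x) := by
    have hI2 : IsManifold (𝓡 n) (minSmoothness ℝ 2) M :=
      IsManifold.of_le (n := ∞) (by simp; norm_cast)
    refine Eq.trans ?_ (mlieBracket_eq_lieBracket _ _ _)
    have hψ : ContMDiffAt 𝓘(ℝ, EuclideanSpace ℝ (Fin n)) (𝓡 n) ∞ (extChartAt (𝓡 n) x).symm
        (extChartAt (𝓡 n) x x) :=
      (contMDiffOn_extChartAt_symm x).contMDiffAt (extChartAt_target_mem_nhds x)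
    refine mpullback_mlieBracket (n := minSmoothness ℝ 2) ?_ ?_
      (hψ.of_le (by simp; norm_cast)) le_rfl
    · exact (hV _).mdifferentiableAt (by simp)
    · exact (hW _).mdifferentiableAt (by simp)
  rw [hpt hf, hsecond hW, hsecond hV, hb]
  exact fderiv_lieBracket_apply hF ((hsmooth hV).differentiableAt (by simp))
    ((hsmooth hW).differentiableAt (by simp))

end Commutator

/-! ### The Lie–Rinehart ring of smooth functions and smooth vector fields -/

variable (n : ℕ) (M : Type*) [TopologicalSpace M] [ChartedSpace (EuclideanSpace ℝ (Fin n)) M]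

/-- The ring `C^∞(M)` of smooth real functions. -/
abbrev SmoothFunction := C^∞⟮𝓡 n, M; 𝓘(ℝ), ℝ⟯

lemma SmoothFunction.mdifferentiableAt {n : ℕ} {M : Type*} [TopologicalSpace M]
    [ChartedSpace (EuclideanSpace ℝ (Fin n)) M] (f : SmoothFunction n M) (x : M) :
    MDifferentiableAt (𝓡 n) 𝓘(ℝ) (fun y ↦ f y) x :=
  (f.contMDiff x).mdifferentiableAt (by simp)

variable [IsManifold (𝓡 n) ∞ M]

/-- The space `Γ(TM)` of smooth vector fields. -/
abbrev SmoothField := Cₛ^∞⟮𝓡 n; EuclideanSpace ℝ (Fin n), (TangentSpace (𝓡 n) : M → Type _)⟯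


variable {n M}

/-- Pointwise multiplication of vector fields by functions. -/
noncomputable instance : Module (SmoothFunction n M) (SmoothField n M) where
  smul f X := ⟨fun x ↦ f x • X x, f.contMDiff.smul_section X.contMDiff⟩
  one_smul X := by ext x : 1; exact one_smul ℝ (X x)
  mul_smul f g X := by ext x : 1; exact mul_smul (f x) (g x) (X x)
  smul_zero f := by ext x : 1; exact smul_zero (f x)
  smul_add f X Y := by ext x : 1; exact smul_add (f x) (X x) (Y x)
  add_smul f g X := by ext x : 1; exact add_smul (f x) (g x) (X x)
  zero_smul X := by ext x : 1; exact zero_smul ℝ (X x)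

lemma SmoothField.isSmoothField (X : SmoothField n M) : IsSmoothField (fun x ↦ X x) :=
  X.contMDiff

lemma SmoothField.isDiffFieldAt (X : SmoothField n M) (x : M) : IsDiffFieldAt (fun x ↦ X x) x :=
  (X.contMDiff x).mdifferentiableAt (by simp)

lemma SmoothField.contMDiffAt_two (X : SmoothField n M) (x : M) :
    ContMDiffAt (𝓡 n) (𝓡 n).tangent (minSmoothness ℝ 2)
      (fun x ↦ (⟨x, X x⟩ : TangentBundle (𝓡 n) M)) x :=
  (X.contMDiff x).of_le (by simp; norm_cast)

lemma isSmoothField_mlieBracket {X Y : Π x : M, TangentSpace (𝓡 n) x} (hX : IsSmoothField X)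
    (hY : IsSmoothField Y) : IsSmoothField (mlieBracket (𝓡 n) X Y) := by
  have : IsManifold (𝓡 n) (((⊤ : ℕ∞) : ℕ∞ω) + 1) M := by simpa
  have : IsManifold (𝓡 n) (minSmoothness ℝ 2) M := IsManifold.of_le (n := ∞) (by simp; norm_cast)
  exact ContDiff.mlieBracket_vectorField (m := (⊤ : ℕ∞)) (n := (⊤ : ℕ∞)) hX hY (by simp)

/-- The Lie bracket of vector fields. -/
noncomputable instance : Bracket (SmoothField n M) (SmoothField n M) where
  bracket X Y := ⟨mlieBracket (𝓡 n) X Y, isSmoothField_mlieBracket X.contMDiff Y.contMDiff⟩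

/-- The directional derivative of a function along a vector field. -/
noncomputable instance : Bracket (SmoothField n M) (SmoothFunction n M) where
  bracket X f :=
    ⟨fun x ↦ mvfderiv (𝓡 n) f x (X x), contMDiff_mvfderiv_apply f.contMDiff X.contMDiff⟩

@[simp] lemma SmoothField.smul_apply (f : SmoothFunction n M) (X : SmoothField n M) (x : M) :
    (f • X) x = f x • X x := rfl

@[simp] lemma SmoothField.lie_apply (X Y : SmoothField n M) (x : M) :
    ⁅X, Y⁆ x = mlieBracket (𝓡 n) X Y x := rfl

@[simp] lemma SmoothField.lie_function_apply (X : SmoothField n M) (f : SmoothFunction n M)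
    (x : M) : ⁅X, f⁆ x = mvfderiv (𝓡 n) f x (X x) := rfl

/-- Smooth vector fields form a Lie ring under the Lie bracket. -/
noncomputable instance : LieRing (SmoothField n M) where
  add_lie X Y Z := by
    ext x : 1
    exact mlieBracket_add_left (X.isDiffFieldAt x) (Y.isDiffFieldAt x)
  lie_add X Y Z := by
    ext x : 1
    exact mlieBracket_add_right (Y.isDiffFieldAt x) (Z.isDiffFieldAt x)
  lie_self X := by
    ext x : 1
    simp
  leibniz_lie X Y Z := by
    have : IsManifold (𝓡 n) (minSmoothness ℝ 3) M := IsManifold.of_le (n := ∞) (by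
      simp; norm_cast)
    ext x : 1
    exact leibniz_identity_mlieBracket_apply (X.contMDiffAt_two x) (Y.contMDiffAt_two x)
      (Z.contMDiffAt_two x)

/-- Smooth vector fields act on smooth functions by directional derivatives. -/
noncomputable instance : LieRingModule (SmoothField n M) (SmoothFunction n M) where
  add_lie X Y f := by
    ext x
    exact map_add (mvfderiv (𝓡 n) f x) (X x) (Y x)
  lie_add X f g := by
    ext x
    exact congrArg (fun l ↦ l (X x))
      (mvfderiv_add (f.mdifferentiableAt x) (g.mdifferentiableAt x))
  leibniz_lie X Y f := by
    ext x
    have h := mvfderiv_mlieBracket f.contMDiff X.contMDiff Y.contMDiff x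
    exact (sub_eq_iff_eq_add.1 h.symm)

instance : LieRinehartRing (SmoothFunction n M) (SmoothField n M) where
  lie_smul_eq_mul' f g X := by
    ext x
    exact map_smul (mvfderiv (𝓡 n) g x) (f x) (X x)
  leibniz_mul_right' X f g := by
    ext x
    have h := congrArg (fun l ↦ l (X x))
      (mvfderiv_mul (f.mdifferentiableAt x) (g.mdifferentiableAt x))
    refine h.trans ?_
    simp [mul_comm]
  leibniz_smul_right' X Y f := by
    ext x : 1
    refine (mlieBracket_smul_right (f.mdifferentiableAt x) (Y.isDiffFieldAt x)).trans ?_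
    exact add_comm _ _

/-! ### One-forms and connections on smooth fields -/

section Forms

variable {n : ℕ} {M : Type*} [TopologicalSpace M] [ChartedSpace (EuclideanSpace ℝ (Fin n)) M]
  [IsManifold (𝓡 n) ∞ M]

lemma OneForm.contMDiff_apply (α : OneForm n M) {X : Π x : M, TangentSpace (𝓡 n) x}
    (hX : IsSmoothField X) : ContMDiff (𝓡 n) 𝓘(ℝ) ∞ (fun y ↦ α y (X y)) := by
  intro x
  have h := ContMDiffAt.clm_bundle_apply (F₂ := ℝ) (E₂ := Bundle.Trivial M ℝ) (α.smooth x) (hX x)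
  rw [contMDiffAt_section] at h
  exact h

/-- A one-form as a `C^∞(M)`-linear map from vector fields to functions. -/
noncomputable def OneForm.toLinearMap (α : OneForm n M) :
    SmoothField n M →ₗ[SmoothFunction n M] SmoothFunction n M where
  toFun X := ⟨fun x ↦ α x (X x), α.contMDiff_apply X.isSmoothField⟩
  map_add' X Y := by
    ext x
    exact map_add (α x) (X x) (Y x)
  map_smul' f X := by
    ext x
    exact map_smul (α x) (f x) (X x)

lemma OneForm.lieExtDeriv_toLinearMap (α : OneForm n M) (X Y : SmoothField n M) (x : M) :
    lieExtDeriv α.toLinearMap X Y x = α.extDeriv x (X x) (Y x) :=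
  (α.extDeriv_apply (X.isDiffFieldAt x) (Y.isDiffFieldAt x)).symm

/-- A smooth connection as an operation on smooth vector fields. -/
noncomputable def covField
    (nabla : CovariantDerivative (𝓡 n) (EuclideanSpace ℝ (Fin n))
      (TangentSpace (𝓡 n) : M → Type _))
    (h : CovariantDerivative.ContMDiffCovariantDerivative nabla ∞) :
    SmoothField n M →ₗ[SmoothFunction n M] SmoothField n M →+ SmoothField n M where
  toFun X := AddMonoidHom.mk'
    (fun Y ↦ ⟨fun x ↦ nabla Y x (X x), fun x ↦ by
      have hY := h.contMDiff.contMDiff (σ := fun x ↦ Y x) (Y.contMDiff.contMDiffOn)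
      exact ContMDiffAt.clm_bundle_apply (hY.contMDiffAt Filter.univ_mem) (X.contMDiff x)⟩)
    (fun Y Z ↦ by
      ext x : 1
      exact congrArg (fun l ↦ l (X x)) (nabla.isCovariantDerivativeOnUniv.add
        (Y.isDiffFieldAt x) (Z.isDiffFieldAt x)))
  map_add' X X' := by
    ext Y x : 2
    exact map_add (nabla Y x) (X x) (X' x)
  map_smul' f X := by
    ext Y x : 2
    exact map_smul (nabla Y x) (f x) (X x)

end Forms

/-! ### The Webster calculus of a transversally symmetric pseudo-Hermitian structure -/

namespace PseudoHermitian

variable {m : ℕ} {M : Type*} [TopologicalSpace M]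
  [ChartedSpace (EuclideanSpace ℝ (Fin (2 * m + 1))) M] [IsManifold (𝓡 (2 * m + 1)) ∞ M]
  {S : CRStructure m M} {P : PseudoHermitian S} (T : P.ReebField)

lemma isSmoothField_proj {X : Π x : M, TangentSpace (𝓡 (2 * m + 1)) x} (hX : IsSmoothField X) :
    IsSmoothField (fun x ↦ (proj T x (X x) : TangentSpace (𝓡 (2 * m + 1)) x)) :=
  ContMDiff.sub_section hX ((P.θ.contMDiff_apply hX).smul_section T.smooth)

lemma isSmoothField_J {X : Π x : M, TangentSpace (𝓡 (2 * m + 1)) x} (hX : IsSmoothField X) :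
    IsSmoothField (fun x ↦ J T x (X x)) :=
  S.smooth_J (fun x ↦ proj T x (X x)) (isSmoothField_proj T hX)

/-- A vector is the sum of its horizontal part and its Reeb part. -/
lemma proj_add_smul (x : M) (v : TangentSpace (𝓡 (2 * m + 1)) x) :
    (proj T x v : TangentSpace (𝓡 (2 * m + 1)) x) + P.θ x v • T x = v :=
  sub_add_cancel v _

lemma J_proj (x : M) (v : TangentSpace (𝓡 (2 * m + 1)) x) : J T x (proj T x v) = J T x v :=
  J_of_mem T x (proj T x v)

lemma J_J (x : M) (v : TangentSpace (𝓡 (2 * m + 1)) x) :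
    J T x (J T x v) = -v + P.θ x v • T x := by
  have h : J T x v = S.J x (proj T x v) := rfl
  rw [h, J_of_mem, S.J_sq]
  change -(v - P.θ x v • T x) = _
  module

lemma theta_J (x : M) (v : TangentSpace (𝓡 (2 * m + 1)) x) : P.θ x (J T x v) = 0 :=
  P.vanish x _ (S.J x (proj T x v)).2

/-- Every horizontal vector is the value of a smooth horizontal vector field. -/
lemma exists_horizontal (T : P.ReebField) [T2Space M] {x : M} (v : S.H x) :
    ∃ X : Π y : M, S.H y, IsSmoothField (fun y ↦ (X y : TangentSpace (𝓡 (2 * m + 1)) y)) ∧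
      X x = v := by
  obtain ⟨X, hX, hv⟩ := exists_isSmoothField (v : TangentSpace (𝓡 (2 * m + 1)) x)
  refine ⟨fun y ↦ proj T y (X y), isSmoothField_proj T hX, ?_⟩
  ext1
  change X x - P.θ x (X x) • T x = v
  rw [hv, P.vanish x v v.2, zero_smul, sub_zero]

/-- On fields annihilated by `α` near `x`, `dα` measures the `α`-component of the bracket. -/
lemma extDeriv_horizontal (α : OneForm (2 * m + 1) M) {x : M}
    {X Y : Π x : M, TangentSpace (𝓡 (2 * m + 1)) x} (hX : IsSmoothField X) (hY : IsSmoothField Y)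
    (hαX : ∀ᶠ y in 𝓝 x, α y (X y) = 0) (hαY : ∀ᶠ y in 𝓝 x, α y (Y y) = 0) :
    α.extDeriv x (X x) (Y x) = -α x (mlieBracket (𝓡 (2 * m + 1)) X Y x) := by
  have h0 : ∀ {Z : Π x : M, TangentSpace (𝓡 (2 * m + 1)) x}, (∀ᶠ y in 𝓝 x, α y (Z y) = 0) →
      mvfderiv (𝓡 (2 * m + 1)) (fun y ↦ α y (Z y)) x = 0 := by
    intro Z hZ
    have hZ' : (fun y ↦ α y (Z y)) =ᶠ[𝓝 x] fun _ ↦ (0 : ℝ) := hZ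
    have := hZ'.mfderiv_eq (I := 𝓡 (2 * m + 1)) (I' := 𝓘(ℝ))
    rw [mvfderiv, this, mfderiv_const]
    ext; rfl
  rw [α.extDeriv_apply ((hX x).mdifferentiableAt (by simp)) ((hY x).mdifferentiableAt (by simp)),
    h0 hαX, h0 hαY]
  simp

/-- Non-degeneracy of the metric is the contact condition on `H`, stated for a local defining form
`α` of `H` in place of `θ`. -/
lemma metric_nondegenerate [T2Space M] (x : M) (v : TangentSpace (𝓡 (2 * m + 1)) x)
    (h : ∀ w, metric T x v w = 0) : v = 0 := by
  have hv : v ∈ S.H x := by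
    have := h (T x)
    rw [metric, levi, J_reeb, map_zero, T.theta_eq_one, zero_add, mul_one] at this
    exact (P.mem_H_iff x v).2 this
  obtain ⟨α, hα⟩ := S.contact x
  refine hα.self_of_nhds.2.2 v hv fun w hw ↦ ?_
  obtain ⟨X, hX, hXv⟩ := exists_horizontal T ⟨v, hv⟩
  obtain ⟨Y, hY, hYw⟩ := exists_horizontal T ⟨w, hw⟩
  have hXv' : (X x : TangentSpace (𝓡 (2 * m + 1)) x) = v := by rw [hXv]
  have hYw' : (Y x : TangentSpace (𝓡 (2 * m + 1)) x) = w := by rw [hYw]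
  -- Both `α` and `θ` have kernel `H` near `x`, so both exterior derivatives test whether the
  -- bracket `[X, Y]` is horizontal.
  have hαXY := extDeriv_horizontal α hX hY
    (hα.mono fun y hy ↦ (hy.2.1 _).1 (X y).2) (hα.mono fun y hy ↦ (hy.2.1 _).1 (Y y).2)
  have hθXY := extDeriv_horizontal P.θ hX hY
    (x := x) (.of_forall fun y ↦ P.vanish y _ (X y).2) (.of_forall fun y ↦ P.vanish y _ (Y y).2)
  have hvw : P.θ.extDeriv x v w = 0 := by
    have := h (-J T x w)
    rwa [metric, levi, map_neg, J_J, P.vanish x w hw, P.vanish x v hv, zero_smul, add_zero, neg_neg,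
      zero_mul, add_zero] at this
  rw [hXv', hYw'] at hαXY hθXY
  rw [hvw, eq_comm, neg_eq_zero, ← P.mem_H_iff, hα.self_of_nhds.2.1] at hθXY
  rw [hαXY, hθXY, neg_zero]

variable {T}

/-- For a transversally symmetric structure the torsion of the Tanaka–Webster connection is
`dθ(J ·, J ·) T` on all of `TM`. -/
lemma IsTanakaWebster.torsion_eq [T2Space M] (hT : IsTransversallySymmetric T)
    {nabla : CovariantDerivative (𝓡 (2 * m + 1)) (EuclideanSpace ℝ (Fin (2 * m + 1)))
      (TangentSpace (𝓡 (2 * m + 1)) : M → Type _)}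
    (hnabla : IsTanakaWebster T nabla) (x : M) (v w : TangentSpace (𝓡 (2 * m + 1)) x) :
    nabla.torsion x v w = P.θ.extDeriv x (J T x v) (J T x w) • T x := by
  have hreeb : ∀ w : S.H x, nabla.torsion x (T x) w = 0 := by
    intro w
    obtain ⟨X, hX, hXw⟩ := exists_horizontal T w
    have h := hnabla.torsion_reeb X hX x
    rwa [hT X hX x, smul_zero, hXw] at h
  have h1 := hreeb (proj T x w)
  have h2 := nabla.torsion_antisymm (proj T x v : TangentSpace (𝓡 (2 * m + 1)) x) (T x)
  rw [hreeb, neg_zero] at h2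
  have h3 := hnabla.torsion_horizontal x _ (proj T x v).2 _ (proj T x w).2
  rw [levi, J_proj, J_proj] at h3
  conv_lhs => rw [← proj_add_smul T x v, ← proj_add_smul T x w]
  simp only [map_add, map_smul, add_apply, smul_apply, h1, h2, h3,
    CovariantDerivative.torsion_self, smul_zero, add_zero]

variable (T)

/-- The extended complex structure `J` as a `C^∞(M)`-linear endomorphism of `Γ(TM)`. -/
noncomputable def JField :
    SmoothField (2 * m + 1) M →ₗ[SmoothFunction (2 * m + 1) M] SmoothField (2 * m + 1) M where
  toFun X := ⟨fun x ↦ J T x (X x), isSmoothField_J T X.isSmoothField⟩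
  map_add' X Y := by
    ext x : 1
    exact map_add (J T x) (X x) (Y x)
  map_smul' f X := by
    ext x : 1
    exact map_smul (J T x) (f x) (X x)

lemma metric_field (X Y : SmoothField (2 * m + 1) M) (x : M) :
    (lieExtDeriv P.θ.toLinearMap X (JField T Y) + P.θ.toLinearMap X * P.θ.toLinearMap Y) x
      = metric T x (X x) (Y x) := by
  change lieExtDeriv P.θ.toLinearMap X (JField T Y) x + _ = _
  rw [OneForm.lieExtDeriv_toLinearMap]
  rfl

variable {T}

/-- A smooth field annihilated by `θ`, as a section of `H`. -/
noncomputable def horizontalSection (X : SmoothField (2 * m + 1) M) (hX : P.θ.toLinearMap X = 0)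
    (x : M) :
    S.H x :=
  ⟨X x, (P.mem_H_iff x _).2 (congrArg (fun f ↦ f x) hX)⟩

lemma J_horizontalSection (T : P.ReebField) (X : SmoothField (2 * m + 1) M)
    (hX : P.θ.toLinearMap X = 0) :
    (fun x ↦ (S.J x (horizontalSection X hX x) : TangentSpace (𝓡 (2 * m + 1)) x))
      = fun x ↦ JField T X x := by
  funext x
  exact (J_of_mem T x (horizontalSection X hX x)).symm

/-- The Webster calculus of smooth functions and vector fields on a transversally symmetric
pseudo-Hermitian manifold. -/
noncomputable def websterCalculus [T2Space M] (hT : IsTransversallySymmetric T)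
    {nabla : CovariantDerivative (𝓡 (2 * m + 1)) (EuclideanSpace ℝ (Fin (2 * m + 1)))
      (TangentSpace (𝓡 (2 * m + 1)) : M → Type _)}
    (hnabla : IsTanakaWebster T nabla) :
    WebsterCalculus (SmoothFunction (2 * m + 1) M) (SmoothField (2 * m + 1) M) where
  θ := P.θ.toLinearMap
  T := ⟨T, T.smooth⟩
  J := JField T
  cov := covField nabla hnabla.smooth
  two_torsion f hf := by
    ext x
    have : f x + f x = 0 := congrArg (fun f ↦ f x) hf
    change f x = 0
    linarith
  θ_T := by
    ext x
    exact T.theta_eq_one x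
  θ_J X := by
    ext x
    exact theta_J T x (X x)
  J_T := by
    ext x : 1
    exact J_reeb T x
  J_J X := by
    ext x : 1
    exact J_J T x (X x)
  interior_T X := by
    ext x
    rw [OneForm.lieExtDeriv_toLinearMap]
    exact T.interior_eq_zero x (X x)
  bracket_mem X Y hX hY := by
    ext x
    have h := S.bracket_mem (horizontalSection X hX) (horizontalSection Y hY) X.isSmoothField
      Y.isSmoothField x
    rw [J_horizontalSection T, J_horizontalSection T] at h
    exact P.vanish x _ h
  integrable X Y hX hY := by
    ext x : 1
    have h := S.integrable (horizontalSection X hX) (horizontalSection Y hY) X.isSmoothField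
      Y.isSmoothField x
    rw [← J_of_mem T] at h
    simp only [J_horizontalSection T] at h
    exact h
  symmetric X hX := by
    ext x : 1
    have h := hT (horizontalSection X hX) X.isSmoothField x
    rw [J_horizontalSection T] at h
    exact h
  nondegenerate X h := by
    ext x : 1
    refine metric_nondegenerate T x (X x) fun w ↦ ?_
    obtain ⟨Y, hY, rfl⟩ := exists_isSmoothField w
    exact (metric_field T X ⟨Y, hY⟩ x).symm.trans (congrArg (fun f ↦ f x) (h ⟨Y, hY⟩))
  cov_smul f X Y := by
    ext x : 1
    exact congrArg (fun l ↦ l (X x)) (nabla.isCovariantDerivativeOnUniv.leibniz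
      (Y.isDiffFieldAt x) (f.mdifferentiableAt x))
  metric_compatible X Y Z := by
    ext x
    have h := hnabla.metric_compatible X Y Z X.isSmoothField Y.isSmoothField Z.isSmoothField x
    simp only [← metric_field T Y Z] at h
    exact h.trans (congrArg₂ (· + ·) (metric_field T (covField nabla hnabla.smooth X Y) Z x).symm
      (metric_field T Y (covField nabla hnabla.smooth X Z) x).symm)
  torsion X Y := by
    ext x : 1
    rw [SmoothField.smul_apply, OneForm.lieExtDeriv_toLinearMap]
    refine Eq.trans ?_ (hnabla.torsion_eq hT x (X x) (Y x))
    exact (nabla.torsion_apply (X.isDiffFieldAt x) (Y.isDiffFieldAt x)).symm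

lemma websterCalculus_R [T2Space M] (hT : IsTransversallySymmetric T)
    {nabla : CovariantDerivative (𝓡 (2 * m + 1)) (EuclideanSpace ℝ (Fin (2 * m + 1)))
      (TangentSpace (𝓡 (2 * m + 1)) : M → Type _)}
    (hnabla : IsTanakaWebster T nabla) (X Y Z V : SmoothField (2 * m + 1) M) (x : M) :
    (websterCalculus hT hnabla).R X Y Z V x = websterCurvature T nabla X Y Z V x :=
  metric_field T ((websterCalculus hT hnabla).curv X Y Z) V x

end PseudoHermitian

end CRGeometry

theorem mainTheorem3 {m : ℕ} {M : Type*} [TopologicalSpace M] [T2Space M]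
    [ChartedSpace (EuclideanSpace ℝ (Fin (2 * m + 1))) M] [IsManifold (𝓡 (2 * m + 1)) ∞ M]
    (S : CRGeometry.CRStructure m M) (P : CRGeometry.PseudoHermitian S) (T : P.ReebField)
    (hT : CRGeometry.PseudoHermitian.IsTransversallySymmetric T)
    (nabla : CovariantDerivative (𝓡 (2 * m + 1)) (EuclideanSpace ℝ (Fin (2 * m + 1)))
      (TangentSpace (𝓡 (2 * m + 1)) : M → Type _))
    (hnabla : CRGeometry.PseudoHermitian.IsTanakaWebster T nabla)
    (X Y Z V : Π x : M, TangentSpace (𝓡 (2 * m + 1)) x)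
    (hX : CRGeometry.IsSmoothField X) (hY : CRGeometry.IsSmoothField Y)
    (hZ : CRGeometry.IsSmoothField Z) (hV : CRGeometry.IsSmoothField V) (x : M) :
    let R := CRGeometry.PseudoHermitian.websterCurvature T nabla
    let J : (Π x : M, TangentSpace (𝓡 (2 * m + 1)) x) → Π x : M, TangentSpace (𝓡 (2 * m + 1)) x :=
      fun W y ↦ CRGeometry.PseudoHermitian.J T y (W y)
    R X Y Z V x + R Y Z X V x + R Z X Y V x = 0 ∧
    R X Y Z V x = R Z V X Y x ∧
    R X (J Y) (J Z) V x = R (J X) Y Z (J V) x := by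
  intro R J
  let W := CRGeometry.PseudoHermitian.websterCalculus hT hnabla
  let X' : CRGeometry.SmoothField (2 * m + 1) M := ⟨X, hX⟩
  let Y' : CRGeometry.SmoothField (2 * m + 1) M := ⟨Y, hY⟩
  let Z' : CRGeometry.SmoothField (2 * m + 1) M := ⟨Z, hZ⟩
  let V' : CRGeometry.SmoothField (2 * m + 1) M := ⟨V, hV⟩
  have hR := fun A B C D ↦
    CRGeometry.PseudoHermitian.websterCalculus_R hT hnabla A B C D x
  refine ⟨?_, ?_, ?_⟩
  · have h := congrArg (fun f ↦ f x) (W.R_cyclic X' Y' Z' V')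
    exact (congrArg₂ (· + ·) (congrArg₂ (· + ·) (hR X' Y' Z' V') (hR Y' Z' X' V'))
      (hR Z' X' Y' V')).symm.trans h
  · have h := congrArg (fun f ↦ f x) (W.R_pair_symm X' Y' Z' V')
    exact (hR X' Y' Z' V').symm.trans (h.trans (hR Z' V' X' Y'))
  · have h := congrArg (fun f ↦ f x) (W.R_J_J X' Y' Z' V')
    exact (hR X' (W.J Y') (W.J Z') V').symm.trans (h.trans (hR (W.J X') Y' Z' (W.J V')))
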